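/- Let $(X,d)$ be a compact metric space and let $R>0$ be such that $X$ is simply connected up to scale $R$, i.e. for every $x\in X$ and every $\rho$ with $0<\rho<R$ the open ball $\{y\in X: d(x,y)<\rho\}$ is simply connected (in particular path connected). For $r>0$ let $\mathrm{Rips}(X,r)$ be the (open) Rips complex, the abstract simplicial complex whose simplices are the nonempty finite subsets of $X$ of diameter less than $r$. Let $G$ be an abelian group, and take homology with coefficients in $G$: simplicial homology for $\mathrm{Rips}(X,r)$ and singular homology for $X$. Then for every $r$ with $0<r<R/3$, $$H_1(\mathrm{Rips}(X,r);G)\cong H_1(X;G).$$ Furthermore, for all $0<r<r'<R/3$ the natural inclusion $\mathrm{Rips}(X,r)\hookrightarrow \mathrm{Rips}(X,r')$ induces an isomorphism $H_1(\mathrm{Rips}(X,r);G)\to H_1(\mathrm{Rips}(X,r');G)$. -/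

import Mathlib

open CategoryTheory Opposite

universe v u

namespace PreAbstractSimplicialComplex

variable {ι : Type u}

open Classical in
/-- The simplicial set of ordered simplices of an abstract simplicial complex `K`: its
`n`-simplices are the `(n+1)`-tuples `(x₀, …, xₙ)` of vertices, repetitions allowed, whose set of
entries `{x₀, …, xₙ}` is a face of `K`; the `i`-th face map omits `xᵢ`. -/
def orderedSSet (K : PreAbstractSimplicialComplex ι) : SSet.{u} where
  obj n := { x : Fin (n.unop.len + 1) → ι // Finset.univ.image x ∈ K.faces }
  map f := TypeCat.ofHom fun x =>
    ⟨x.1 ∘ f.unop.toOrderHom, (K.isRelLowerSet_faces x.2).2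
      (by
        intro a ha
        obtain ⟨i, -, rfl⟩ := Finset.mem_image.1 ha
        exact Finset.mem_image_of_mem x.1 (Finset.mem_univ (f.unop.toOrderHom i)))
      (Finset.univ_nonempty.image _)⟩

/-- The map of ordered simplices induced by an inclusion `K ≤ L` of abstract simplicial complexes. -/
def orderedSSetIncl {K L : PreAbstractSimplicialComplex ι} (h : K ≤ L) :
    K.orderedSSet ⟶ L.orderedSSet where
  app _ := TypeCat.ofHom fun x => ⟨x.1, h x.2⟩

/-- The `n`-th simplicial homology group of an abstract simplicial complex `K` with coefficients in
the abelian group `G`: the homology of the complex of ordered chains of `K`, whose `n`-chains are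
the finite formal `G`-linear combinations of the tuples `(x₀, …, xₙ)` of vertices spanning a face
of `K`, with boundary `∂ (x₀, …, xₙ) = ∑ i, (-1)^i (x₀, …, x̂ᵢ, …, xₙ)`. -/
noncomputable def simplicialHomology (K : PreAbstractSimplicialComplex ι)
    (G : AddCommGrpCat.{max u v}) (n : ℕ) : AddCommGrpCat.{max u v} :=
  K.orderedSSet.homology G n

/-- The homomorphism of simplicial homology groups induced by an inclusion `K ≤ L`. -/
noncomputable def simplicialHomologyIncl {K L : PreAbstractSimplicialComplex ι} (h : K ≤ L)
    (G : AddCommGrpCat.{max u v}) (n : ℕ) :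
    K.simplicialHomology G n ⟶ L.simplicialHomology G n :=
  SSet.homologyMap (orderedSSetIncl h) G n

end PreAbstractSimplicialComplex

/-- The (open) Rips complex of `X` at scale `r`: a nonempty finite subset of `X` is a simplex iff
its diameter is less than `r`. -/
def Rips (X : Type u) [MetricSpace X] (r : ℝ) : PreAbstractSimplicialComplex X where
  faces := { σ | σ.Nonempty ∧ Metric.diam (σ : Set X) < r }
  isRelLowerSet_faces := fun _ hσ =>
    ⟨hσ.1, fun _ hτ hne => ⟨hne, lt_of_le_of_lt
      (Metric.diam_mono (Finset.coe_subset.2 hτ) (Finset.finite_toSet _).isBounded) hσ.2⟩⟩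

/-- The natural inclusion `Rips(X, r) ⊆ Rips(X, s)` for `r ≤ s`. -/
theorem Rips_mono (X : Type u) [MetricSpace X] {r s : ℝ} (h : r ≤ s) : Rips X r ≤ Rips X s :=
  fun _ hσ => ⟨hσ.1, lt_of_lt_of_le hσ.2 h⟩

/-- `X` is simply connected up to scale `R`: every open ball of positive radius less than `R` is
simply connected (in particular path connected). -/
def SimplyConnectedUpToScale (X : Type u) [MetricSpace X] (R : ℝ) : Prop :=
  ∀ (x : X) (r : ℝ), 0 < r → r < R → IsSimplyConnected (Metric.ball x r)

/-- The `n`-th singular homology group of a topological space `X` with coefficients in `G`. -/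
noncomputable def singularHomologyGroup (X : Type u) [TopologicalSpace X]
    (G : AddCommGrpCat.{max u v}) (n : ℕ) : AddCommGrpCat.{max u v} :=
  ((AlgebraicTopology.singularHomologyFunctor.{u} AddCommGrpCat.{max u v} n).obj G).obj
    (TopCat.of X)

/-! Two maps of chains in low degrees compare `X` with its Rips complex. `Rips.sampling` replaces a
singular edge, that is a path, by the sum of Rips edges through finely spaced points on it;
`Rips.filling` replaces a Rips edge `x y` by a path from `x` to `y` inside the ball of radius `r`
about `x`.

Modulo boundaries they are inverse to each other. A filled edge stays within `r` of its first
vertex, so its samples can be coned off from there (`Rips.chainClass_sampling_filling`). A piece of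
a finely subdivided path and the short path replacing it share endpoints and lie in one ball of
radius `2 * r`, which is simply connected since `2 * r < R` (`Rips.chainClass_filling_sampling`).

Sampling respects triangles because a fine grid on a square has null-homologous boundary
(`Rips.sum_edgeClass_grid`); filling respects them again by simple connectedness of `2 * r`-balls
(`Rips.pathClass_shortPath_add`).

Everything is computed with integral chains and transported to the coefficients. Only degrees 2, 1,
0 matter for first homology, and on 2-simplices it suffices that fillers exist. Sampling at scale
`r` followed by inclusion agrees in homology with sampling at scale `r'`, so the inclusion is an
isomorphism by two out of three. -/

/-- Morphisms of short complexes which agree on the third term, and on the second one up to a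
homotopy, induce the same map in homology. -/
lemma CategoryTheory.ShortComplex.homologyMap_eq_of_homotopic {C : Type*} [Category* C]
    [Preadditive C] {S T : ShortComplex C} [S.HasHomology] [T.HasHomology] {φ ψ : S ⟶ T}
    (h : S.X₂ ⟶ T.X₁) (h₂ : φ.τ₂ = h ≫ T.f + ψ.τ₂) (h₃ : φ.τ₃ = ψ.τ₃) :
    ShortComplex.homologyMap φ = ShortComplex.homologyMap ψ := by
  refine ShortComplex.Homotopy.homologyMap_congr
    -- On the first term the homotopy only has to differ by a map killed by `T.f`, so `h₀` absorbs
    -- whatever discrepancy remains there.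
    { h₀ := φ.τ₁ - ψ.τ₁ - S.f ≫ h
      h₁ := h
      h₂ := 0
      h₃ := 0
      h₀_f := ?_
      comm₁ := by abel
      comm₂ := by simpa using h₂
      comm₃ := by simpa using h₃ }
  simp only [Preadditive.sub_comp, Category.assoc, φ.comm₁₂, ψ.comm₁₂]
  rw [h₂]
  simp

/-! ### First homology with coefficients, controlled by integral chains. -/

namespace SSet

open Simplicial Limits

/-- The boundary of integral simplicial chains. -/
noncomputable def intBoundary (X : SSet.{u}) (n : ℕ) :
    FreeAbelianGroup (X _⦋n + 1⦌) →+ FreeAbelianGroup (X _⦋n⦌) :=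
  FreeAbelianGroup.lift fun x =>
    ∑ i : Fin (n + 2), (-1 : ℤ) ^ i.val • FreeAbelianGroup.of (X.δ i x)

/-- Integral `1`-chains modulo boundaries. -/
abbrev ChainClass (X : SSet.{u}) : Type u :=
  FreeAbelianGroup (X _⦋1⦌) ⧸ (X.intBoundary 1).range

/-- The class of an integral `1`-chain modulo boundaries. -/
noncomputable def chainClass (X : SSet.{u}) : FreeAbelianGroup (X _⦋1⦌) →+ X.ChainClass :=
  QuotientAddGroup.mk' _

lemma chainClass_eq_iff {X : SSet.{u}} {c c' : FreeAbelianGroup (X _⦋1⦌)} :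
    X.chainClass c = X.chainClass c' ↔ ∃ b, X.intBoundary 1 b = c - c' := by
  rw [← sub_eq_zero, ← map_sub]
  exact QuotientAddGroup.eq_zero_iff _

lemma intBoundary_zero_of (X : SSet.{u}) (x : X _⦋1⦌) :
    X.intBoundary 0 (.of x) = .of (X.δ 0 x) - .of (X.δ 1 x) := by
  simp [intBoundary, Fin.sum_univ_two, sub_eq_add_neg]

lemma intBoundary_one_of (X : SSet.{u}) (x : X _⦋2⦌) :
    X.intBoundary 1 (.of x) = .of (X.δ 0 x) - .of (X.δ 1 x) + .of (X.δ 2 x) := by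
  simp [intBoundary, Fin.sum_univ_three, sub_eq_add_neg]

lemma chainClass_triangle (X : SSet.{u}) (x : X _⦋2⦌) :
    X.chainClass (.of (X.δ 0 x)) + X.chainClass (.of (X.δ 2 x)) =
      X.chainClass (.of (X.δ 1 x)) := by
  rw [← map_add, chainClass_eq_iff]
  refine ⟨.of x, ?_⟩
  rw [intBoundary_one_of]
  abel

variable {C : Type*} [Category* C] [Preadditive C] [HasCoproducts.{u} C]

/-- The morphism from the coefficients to `n`-chains given by an integral `n`-chain. -/
noncomputable def chainHom (X : SSet.{u}) (A : C) (n : ℕ) :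
    FreeAbelianGroup (X _⦋n⦌) →+ (A ⟶ (X.chainComplex A).X n) :=
  FreeAbelianGroup.lift fun x => X.ιChainComplex x

@[simp]
lemma chainHom_of (X : SSet.{u}) (A : C) (n : ℕ) (x : X _⦋n⦌) :
    X.chainHom A n (.of x) = X.ιChainComplex x := by
  simp [chainHom]

/-- This reduces boundary computations with arbitrary coefficients to integral ones. -/
lemma chainHom_d (X : SSet.{u}) (A : C) (n : ℕ) (c : FreeAbelianGroup (X _⦋n + 1⦌)) :
    X.chainHom A (n + 1) c ≫ (X.chainComplex A).d (n + 1) n =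
      X.chainHom A n (X.intBoundary n c) := by
  induction c using FreeAbelianGroup.induction_on with
  | zero => simp
  | of x => simp [intBoundary]
  | neg x h => simp only [map_neg, Preadditive.neg_comp, h]
  | add x y hx hy => simp only [map_add, Preadditive.add_comp, hx, hy]

lemma chainHom_d_assoc (X : SSet.{u}) (A : C) (n : ℕ) (c : FreeAbelianGroup (X _⦋n + 1⦌))
    {T : C} (h : (X.chainComplex A).X n ⟶ T) :
    X.chainHom A (n + 1) c ≫ (X.chainComplex A).d (n + 1) n ≫ h =
      X.chainHom A n (X.intBoundary n c) ≫ h := by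
  rw [← Category.assoc, chainHom_d]

/-- The morphism on chains with coefficients induced by an assignment of integral chains to
simplices. -/
noncomputable def chainDesc {X Y : SSet.{u}} (A : C) {n m : ℕ}
    (f : X _⦋n⦌ → FreeAbelianGroup (Y _⦋m⦌)) :
    (X.chainComplex A).X n ⟶ (Y.chainComplex A).X m :=
  Cofan.IsColimit.desc (X.isColimitChainComplexXCofan A n) fun x => Y.chainHom A m (f x)

@[simp]
lemma ι_chainDesc {X Y : SSet.{u}} (A : C) {n m : ℕ}
    (f : X _⦋n⦌ → FreeAbelianGroup (Y _⦋m⦌)) (x : X _⦋n⦌) :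
    X.ιChainComplex x ≫ chainDesc A f = Y.chainHom A m (f x) :=
  Cofan.IsColimit.fac (X.isColimitChainComplexXCofan A n) _ x

lemma ι_chainDesc_assoc {X Y : SSet.{u}} (A : C) {n m : ℕ}
    (f : X _⦋n⦌ → FreeAbelianGroup (Y _⦋m⦌)) (x : X _⦋n⦌) {T : C}
    (h : (Y.chainComplex A).X m ⟶ T) :
    X.ιChainComplex x ≫ chainDesc A f ≫ h = Y.chainHom A m (f x) ≫ h := by
  rw [← Category.assoc, ι_chainDesc]

lemma chainHom_chainDesc {X Y : SSet.{u}} (A : C) {n m : ℕ}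
    (f : X _⦋n⦌ → FreeAbelianGroup (Y _⦋m⦌)) (c : FreeAbelianGroup (X _⦋n⦌)) :
    X.chainHom A n c ≫ chainDesc A f = Y.chainHom A m (FreeAbelianGroup.lift f c) := by
  induction c using FreeAbelianGroup.induction_on with
  | zero => simp
  | of x => simp
  | neg x h => simp only [map_neg, Preadditive.neg_comp, h]
  | add x y hx hy => simp only [map_add, Preadditive.add_comp, hx, hy]

lemma chainDesc_comp {X Y Z : SSet.{u}} (A : C) {n m k : ℕ}
    (f : X _⦋n⦌ → FreeAbelianGroup (Y _⦋m⦌)) (g : Y _⦋m⦌ → FreeAbelianGroup (Z _⦋k⦌)) :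
    chainDesc A f ≫ chainDesc A g = chainDesc A fun x => FreeAbelianGroup.lift g (f x) := by
  refine chainComplex_hom_ext fun x => ?_
  rw [ι_chainDesc_assoc, chainHom_chainDesc, ι_chainDesc]

lemma chainDesc_of (X : SSet.{u}) (A : C) (n : ℕ) :
    chainDesc A (FreeAbelianGroup.of : X _⦋n⦌ → _) = 𝟙 ((X.chainComplex A).X n) := by
  refine chainComplex_hom_ext fun x => ?_
  simp

lemma chainComplexMap_f_eq_chainDesc {X Y : SSet.{u}} (i : X ⟶ Y) (A : C) (n : ℕ) :
    (chainComplexMap i A).f n = chainDesc A fun x => .of (i.app _ x) := by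
  refine chainComplex_hom_ext fun x => ?_
  simp

/-- A map between integral chains in degrees `0` and `1` that is compatible with boundaries. -/
structure LowDegreeMap (X Y : SSet.{u}) where
  /-- the map on vertices -/
  onVertex : X _⦋0⦌ → Y _⦋0⦌
  /-- the map on edges -/
  onEdge : X _⦋1⦌ → FreeAbelianGroup (Y _⦋1⦌)
  boundary_onEdge (x : X _⦋1⦌) :
    Y.intBoundary 0 (onEdge x) = .of (onVertex (X.δ 0 x)) - .of (onVertex (X.δ 1 x))
  triangle (x : X _⦋2⦌) :
    Y.chainClass (onEdge (X.δ 0 x)) + Y.chainClass (onEdge (X.δ 2 x)) =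
      Y.chainClass (onEdge (X.δ 1 x))

namespace LowDegreeMap

variable {X Y Z : SSet.{u}} (f : LowDegreeMap X Y)

lemma exists_filler (x : X _⦋2⦌) : ∃ b, Y.intBoundary 1 b =
    f.onEdge (X.δ 0 x) + f.onEdge (X.δ 2 x) - f.onEdge (X.δ 1 x) := by
  rw [← chainClass_eq_iff, map_add, f.triangle]

/-- The morphism of truncated chain complexes induced by a `LowDegreeMap`. -/
noncomputable def shortMap (A : C) :
    (X.chainComplex A).sc' 2 1 0 ⟶ (Y.chainComplex A).sc' 2 1 0 where
  -- Any choice of fillers will do: the map induced on homology at the middle term does not depend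
  -- on `τ₁`.
  τ₁ := chainDesc A fun x => (f.exists_filler x).choose
  τ₂ := chainDesc A f.onEdge
  τ₃ := chainDesc A fun x => .of (f.onVertex x)
  comm₁₂ := by
    apply chainComplex_hom_ext
    intro x
    dsimp [HomologicalComplex.sc', HomologicalComplex.shortComplexFunctor']
    rw [ι_chainDesc_assoc, chainHom_d, (f.exists_filler x).choose_spec,
      ← chainHom_of, chainHom_d_assoc, chainHom_chainDesc, intBoundary_one_of]
    congr 1
    simp [sub_eq_add_neg, add_right_comm]
  comm₂₃ := by
    apply chainComplex_hom_ext
    intro x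
    dsimp [HomologicalComplex.sc', HomologicalComplex.shortComplexFunctor']
    rw [ι_chainDesc_assoc, chainHom_d, f.boundary_onEdge,
      ← chainHom_of, chainHom_d_assoc, chainHom_chainDesc, intBoundary_zero_of]
    simp

end LowDegreeMap

/-- Morphisms of truncated chain complexes which agree on vertices and agree on edges up to
boundaries induce the same map in homology. -/
lemma shortComplex_homologyMap_eq [CategoryWithHomology C] {X Y : SSet.{u}} {A : C}
    {φ ψ : (X.chainComplex A).sc' 2 1 0 ⟶ (Y.chainComplex A).sc' 2 1 0}
    {f g : X _⦋1⦌ → FreeAbelianGroup (Y _⦋1⦌)}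
    (h₀ : φ.τ₃ = ψ.τ₃) (hf : φ.τ₂ = chainDesc A f) (hg : ψ.τ₂ = chainDesc A g)
    (h₁ : ∀ x, Y.chainClass (f x) = Y.chainClass (g x)) :
    ShortComplex.homologyMap φ = ShortComplex.homologyMap ψ := by
  choose b hb using fun x => chainClass_eq_iff.1 (h₁ x)
  refine ShortComplex.homologyMap_eq_of_homotopic (chainDesc A b) ?_ h₀
  rw [hf, hg]
  have key : chainDesc A f =
      chainDesc A b ≫ (Y.chainComplex A).d 2 1 + chainDesc A g := by
    apply chainComplex_hom_ext
    intro x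
    rw [Preadditive.comp_add, ι_chainDesc_assoc, chainHom_d, hb]
    simp
  exact key

variable [CategoryWithHomology C] {X Y Z : SSet.{u}}

lemma LowDegreeMap.homologyMap_comp_eq_id (A : C) (f : LowDegreeMap X Y) (g : LowDegreeMap Y X)
    (h₀ : ∀ x, g.onVertex (f.onVertex x) = x)
    (h₁ : ∀ x, X.chainClass (FreeAbelianGroup.lift g.onEdge (f.onEdge x)) =
      X.chainClass (.of x)) :
    ShortComplex.homologyMap (f.shortMap A) ≫ ShortComplex.homologyMap (g.shortMap A) = 𝟙 _ := by
  rw [← ShortComplex.homologyMap_comp, ← ShortComplex.homologyMap_id]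
  refine shortComplex_homologyMap_eq (A := A) ?_ ?_ ?_ h₁
  · refine (chainDesc_comp A _ _).trans ?_
    simp only [FreeAbelianGroup.lift_apply_of, h₀]
    exact chainDesc_of X A 0
  · exact chainDesc_comp A _ _
  · exact (chainDesc_of X A 1).symm

/-- Mutually inverse (up to boundaries) maps of chains in low degrees induce an isomorphism on
homology of truncated chain complexes. -/
noncomputable def LowDegreeMap.shortIso (A : C) (f : LowDegreeMap X Y) (g : LowDegreeMap Y X)
    (h₀ : ∀ x, g.onVertex (f.onVertex x) = x)
    (h₁ : ∀ x, X.chainClass (FreeAbelianGroup.lift g.onEdge (f.onEdge x)) =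
      X.chainClass (.of x))
    (h₀' : ∀ y, f.onVertex (g.onVertex y) = y)
    (h₁' : ∀ y, Y.chainClass (FreeAbelianGroup.lift f.onEdge (g.onEdge y)) =
      Y.chainClass (.of y)) :
    ((X.chainComplex A).sc' 2 1 0).homology ≅ ((Y.chainComplex A).sc' 2 1 0).homology where
  hom := ShortComplex.homologyMap (f.shortMap A)
  inv := ShortComplex.homologyMap (g.shortMap A)
  hom_inv_id := homologyMap_comp_eq_id A f g h₀ h₁
  inv_hom_id := homologyMap_comp_eq_id A g f h₀' h₁'

/-- The first homology of a simplicial set in terms of its truncated chain complex. -/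
noncomputable def homologyOneIso (X : SSet.{u}) (A : C) :
    X.homology A 1 ≅ ((X.chainComplex A).sc' 2 1 0).homology :=
  ShortComplex.homologyMapIso
    ((HomologicalComplex.natIsoSc' C (.down ℕ) 2 1 0 (by simp) (by simp)).app _)

lemma isIso_homologyMap_one (A : C) (i : X ⟶ Y)
    (h : IsIso (ShortComplex.homologyMap
      ((HomologicalComplex.shortComplexFunctor' C (.down ℕ) 2 1 0).map (chainComplexMap i A)))) :
    IsIso (SSet.homologyMap i A 1) := by
  have e : SSet.homologyMap i A 1 = (homologyOneIso X A).hom ≫ (ShortComplex.homologyMap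
      ((HomologicalComplex.shortComplexFunctor' C (.down ℕ) 2 1 0).map (chainComplexMap i A))) ≫
        (homologyOneIso Y A).inv := by
    rw [← Category.assoc, Iso.eq_comp_inv]
    refine (ShortComplex.homologyMap_comp _ _).symm.trans
      (Eq.trans ?_ (ShortComplex.homologyMap_comp _ _))
    congr 1
    exact (HomologicalComplex.natIsoSc' C (.down ℕ) 2 1 0
      (by simp) (by simp)).hom.naturality (chainComplexMap i A)
  rw [e]
  infer_instance

lemma LowDegreeMap.homologyMap_comp_incl (A : C) (f : LowDegreeMap Z X) (g : LowDegreeMap Z Y)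
    (i : X ⟶ Y) (h₀ : ∀ z, i.app _ (f.onVertex z) = g.onVertex z)
    (h₁ : ∀ z, Y.chainClass (FreeAbelianGroup.map (i.app (op ⦋1⦌)) (f.onEdge z)) =
      Y.chainClass (g.onEdge z)) :
    ShortComplex.homologyMap (f.shortMap A) ≫ ShortComplex.homologyMap
      ((HomologicalComplex.shortComplexFunctor' C (.down ℕ) 2 1 0).map (chainComplexMap i A)) =
      ShortComplex.homologyMap (g.shortMap A) := by
  rw [← ShortComplex.homologyMap_comp]
  refine shortComplex_homologyMap_eq (A := A) ?_ ?_ rfl h₁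
  · refine (congrArg (_ ≫ ·) (chainComplexMap_f_eq_chainDesc i A 0)).trans ?_
    refine (chainDesc_comp A _ _).trans ?_
    simp only [FreeAbelianGroup.lift_apply_of, h₀]
    rfl
  · refine (congrArg (_ ≫ ·) (chainComplexMap_f_eq_chainDesc i A 1)).trans ?_
    exact chainDesc_comp A _ _

end SSet

/-! ### Singular edges as paths, and their classes modulo boundaries. -/

section Singular

open Simplicial unitInterval

variable {X : Type u} [TopologicalSpace X]

variable (X) in
/-- The singular simplicial set of a topological space. -/
noncomputable abbrev singularSSet : SSet.{u} := TopCat.toSSet.obj (TopCat.of X)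

namespace singularSSet

/-- Singular simplices as continuous maps on a standard simplex. -/
noncomputable def simplexEquiv (n : ℕ) :
    (singularSSet X) _⦋n⦌ ≃ C(stdSimplex ℝ (Fin (n + 1)), X) :=
  TopCat.toSSetObjEquiv (TopCat.of X) (op ⦋n⦌)

lemma simplexEquiv_δ (n : ℕ) (i : Fin (n + 2)) (x : (singularSSet X) _⦋n + 1⦌)
    (s : stdSimplex ℝ (Fin (n + 1))) :
    simplexEquiv n ((singularSSet X).δ i x) s =
      simplexEquiv (n + 1) x (stdSimplex.map i.succAbove s) :=
  rfl

/-- Singular `0`-simplices are points. -/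
noncomputable def vertexEquiv : (singularSSet X) _⦋0⦌ ≃ X :=
  (simplexEquiv 0).trans
    { toFun := fun f => f default
      invFun := fun x => ContinuousMap.const _ x
      left_inv := fun f => by
        ext s
        rw [Subsingleton.elim s default]
        rfl
      right_inv := fun x => rfl }

lemma vertexEquiv_apply (x : (singularSSet X) _⦋0⦌) :
    vertexEquiv x = simplexEquiv 0 x default := rfl

/-- Singular `1`-simplices are paths. -/
noncomputable def edgeEquiv : (singularSSet X) _⦋1⦌ ≃ C(I, X) :=
  (simplexEquiv 1).trans
    (stdSimplexHomeomorphUnitInterval.continuousMapCongr (Homeomorph.refl X))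

lemma edgeEquiv_apply (x : (singularSSet X) _⦋1⦌) (t : I) :
    edgeEquiv x t = simplexEquiv 1 x (stdSimplexHomeomorphUnitInterval.symm t) := rfl

lemma _root_.stdSimplex.map_succAbove_apply_self {n : ℕ} (i : Fin (n + 2))
    (s : stdSimplex ℝ (Fin (n + 1))) : stdSimplex.map i.succAbove s i = 0 := by
  rw [stdSimplex.map_coe, FunOnFinite.linearMap_apply_apply]
  refine Finset.sum_eq_zero fun j hj => ?_
  exact absurd (Finset.mem_filter.1 hj).2 (Fin.succAbove_ne i j)

lemma _root_.stdSimplex.map_succAbove_apply_succAbove {n : ℕ} (i : Fin (n + 2)) (j : Fin (n + 1))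
    (s : stdSimplex ℝ (Fin (n + 1))) : stdSimplex.map i.succAbove s (i.succAbove j) = s j := by
  rw [stdSimplex.map_coe, FunOnFinite.linearMap_apply_apply]
  refine Finset.sum_eq_single_of_mem j (by simp) fun k hk hkj => ?_
  exact absurd (Fin.succAbove_right_injective (Finset.mem_filter.1 hk).2) hkj

lemma _root_.stdSimplex.map_succAbove_eq {n : ℕ} {i : Fin (n + 2)} {s : stdSimplex ℝ (Fin (n + 1))}
    {u : stdSimplex ℝ (Fin (n + 2))} (h₀ : u i = 0) (h₁ : ∀ j, u (i.succAbove j) = s j) :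
    stdSimplex.map i.succAbove s = u := by
  refine stdSimplex.ext (funext fun k => ?_)
  induction k using i.succAboveCases with
  | x => rw [stdSimplex.map_succAbove_apply_self, h₀]
  | p j => rw [stdSimplex.map_succAbove_apply_succAbove, h₁]

/-- The parameter `t` corresponds to barycentric coordinates `(1 - t, t)`, so omitting vertex `0`
leaves the endpoint at `t = 1`. -/
lemma vertexEquiv_δ_zero (x : (singularSSet X) _⦋1⦌) :
    vertexEquiv ((singularSSet X).δ 0 x) = edgeEquiv x 1 := by
  rw [vertexEquiv_apply, edgeEquiv_apply, simplexEquiv_δ]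
  refine congrArg (simplexEquiv 1 x) (stdSimplex.map_succAbove_eq (sub_self 1) fun j => ?_)
  fin_cases j
  rfl

lemma vertexEquiv_δ_one (x : (singularSSet X) _⦋1⦌) :
    vertexEquiv ((singularSSet X).δ 1 x) = edgeEquiv x 0 := by
  rw [vertexEquiv_apply, edgeEquiv_apply, simplexEquiv_δ]
  refine congrArg (simplexEquiv 1 x) (stdSimplex.map_succAbove_eq rfl fun j => ?_)
  fin_cases j
  exact sub_zero 1

/-- The point of the standard triangle with the given coordinates. -/
def trianglePoint (a b c : ℝ) (ha : 0 ≤ a) (hb : 0 ≤ b) (hc : 0 ≤ c) (h : a + b + c = 1) :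
    stdSimplex ℝ (Fin 3) :=
  ⟨![a, b, c], by
    refine ⟨fun i => ?_, by simpa [Fin.sum_univ_three] using h⟩
    fin_cases i <;> simpa⟩

lemma edgeEquiv_δ_zero (x : (singularSSet X) _⦋2⦌) (t : I) :
    edgeEquiv ((singularSSet X).δ 0 x) t = simplexEquiv 2 x
      (trianglePoint 0 (1 - t) t le_rfl (sub_nonneg.2 t.2.2) t.2.1 (by ring)) := by
  rw [edgeEquiv_apply, simplexEquiv_δ]
  refine congrArg (simplexEquiv 2 x) (stdSimplex.map_succAbove_eq rfl fun j => ?_)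
  fin_cases j <;> rfl

lemma edgeEquiv_δ_one (x : (singularSSet X) _⦋2⦌) (t : I) :
    edgeEquiv ((singularSSet X).δ 1 x) t = simplexEquiv 2 x
      (trianglePoint (1 - t) 0 t (sub_nonneg.2 t.2.2) le_rfl t.2.1 (by ring)) := by
  rw [edgeEquiv_apply, simplexEquiv_δ]
  refine congrArg (simplexEquiv 2 x) (stdSimplex.map_succAbove_eq rfl fun j => ?_)
  fin_cases j <;> rfl

lemma edgeEquiv_δ_two (x : (singularSSet X) _⦋2⦌) (t : I) :
    edgeEquiv ((singularSSet X).δ 2 x) t = simplexEquiv 2 x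
      (trianglePoint (1 - t) t 0 (sub_nonneg.2 t.2.2) t.2.1 le_rfl (by ring)) := by
  rw [edgeEquiv_apply, simplexEquiv_δ]
  refine congrArg (simplexEquiv 2 x) (stdSimplex.map_succAbove_eq rfl fun j => ?_)
  fin_cases j <;> rfl

/-- The class of a path modulo boundaries. -/
noncomputable def pathClass (p : C(I, X)) : (singularSSet X).ChainClass :=
  (singularSSet X).chainClass (.of (edgeEquiv.symm p))

section Affine

variable {E : Type*} [AddCommGroup E] [Module ℝ E] [TopologicalSpace E] [ContinuousAdd E]
  [ContinuousSMul ℝ E]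

/-- The restriction of a map defined on a vector space to a segment. -/
def segment (F : C(E, X)) (a b : E) : C(I, X) where
  toFun t := F ((1 - t : ℝ) • a + (t : ℝ) • b)

@[simp]
lemma segment_apply (F : C(E, X)) (a b : E) (t : I) :
    segment F a b t = F ((1 - t : ℝ) • a + (t : ℝ) • b) := rfl

/-- The affine triangle `a b c` composed with `F` is a singular 2-simplex with these three segments
as faces. Constants, subdivisions, homotopies and concatenations are all handled by suitable choices
of `F`. -/
lemma pathClass_segment_add (F : C(E, X)) (a b c : E) :
    pathClass (segment F a b) + pathClass (segment F b c) = pathClass (segment F a c) := by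
  let f : C(stdSimplex ℝ (Fin 3), X) :=
    ⟨fun s => F (s.1 0 • a + s.1 1 • b + s.1 2 • c), F.continuous.comp
      (by
        have h (i : Fin 3) : Continuous fun s : stdSimplex ℝ (Fin 3) => s.1 i :=
          (continuous_apply i).comp continuous_subtype_val
        exact (((h 0).smul continuous_const).add ((h 1).smul continuous_const)).add
          ((h 2).smul continuous_const))⟩
  have h := (singularSSet X).chainClass_triangle ((simplexEquiv 2).symm f)
  have h0 : (singularSSet X).δ 0 ((simplexEquiv 2).symm f) = edgeEquiv.symm (segment F b c) := by
    rw [Equiv.eq_symm_apply]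
    ext t
    rw [edgeEquiv_δ_zero, Equiv.apply_symm_apply]
    simp [f, trianglePoint]
  have h1 : (singularSSet X).δ 1 ((simplexEquiv 2).symm f) = edgeEquiv.symm (segment F a c) := by
    rw [Equiv.eq_symm_apply]
    ext t
    rw [edgeEquiv_δ_one, Equiv.apply_symm_apply]
    simp [f, trianglePoint]
  have h2 : (singularSSet X).δ 2 ((simplexEquiv 2).symm f) = edgeEquiv.symm (segment F a b) := by
    rw [Equiv.eq_symm_apply]
    ext t
    rw [edgeEquiv_δ_two, Equiv.apply_symm_apply]
    simp [f, trianglePoint]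
  rw [h0, h1, h2, add_comm] at h
  exact h

lemma pathClass_const (x : X) : pathClass (ContinuousMap.const I x) = 0 := by
  have h := pathClass_segment_add (ContinuousMap.const ℝ x) 0 0 0
  exact add_eq_left.1 h

lemma sum_pathClass_segment (F : C(E, X)) (a : ℕ → E) (n : ℕ) :
    ∑ i ∈ Finset.range n, pathClass (segment F (a i) (a (i + 1))) =
      pathClass (segment F (a 0) (a n)) := by
  induction n with
  | zero =>
    have h := pathClass_segment_add F (a 0) (a 0) (a 0)
    simpa using (add_eq_left.1 h).symm
  | succ n ih => rw [Finset.sum_range_succ, ih, pathClass_segment_add]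

end Affine

/-- Going around the homotopy square either way gives the class of its diagonal; the two sides
traced by the endpoints are constant and contribute zero. Clamping extends the homotopy to the
plane. -/
lemma pathClass_eq_of_homotopic {x y : X} {p q : Path x y} (h : p.Homotopic q) :
    pathClass p.toContinuousMap = pathClass q.toContinuousMap := by
  obtain ⟨H⟩ := h
  let F : C(ℝ × ℝ, X) :=
    ⟨fun z => H (Set.projIcc 0 1 zero_le_one z.1, Set.projIcc 0 1 zero_le_one z.2),
      H.continuous.comp (by fun_prop)⟩
  have e1 : segment F (0, 0) (0, 1) = p.toContinuousMap := by
    ext t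
    simp [F]
  have e2 : segment F (0, 1) (1, 1) = ContinuousMap.const I y := by
    ext t
    simp [F]
  have e3 : segment F (0, 0) (1, 0) = ContinuousMap.const I x := by
    ext t
    simp [F]
  have e4 : segment F (1, 0) (1, 1) = q.toContinuousMap := by
    ext t
    simp [F]
  have h1 := pathClass_segment_add F (0, 0) (0, 1) (1, 1)
  have h2 := pathClass_segment_add F (0, 0) (1, 0) (1, 1)
  rw [e1, e2, pathClass_const, add_zero] at h1
  rw [e3, e4, pathClass_const, zero_add] at h2
  rw [h1, h2]

/-- Up to parametrization by segments, `p` and `q` are the two halves of `p.trans q`. -/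
lemma pathClass_trans {x y z : X} (p : Path x y) (q : Path y z) :
    pathClass (p.trans q).toContinuousMap =
      pathClass p.toContinuousMap + pathClass q.toContinuousMap := by
  let F : C(ℝ, X) := ⟨(p.trans q).extend, (p.trans q).continuous_extend⟩
  have e1 : segment F 0 2⁻¹ = p.toContinuousMap := by
    ext t
    have ht := t.2.2
    have : (p.trans q).extend ((t : ℝ) * 2⁻¹) = p t := by
      rw [Path.extend_trans_of_le_half _ _ (by linarith), mul_comm,
        inv_mul_cancel_right₀ two_ne_zero, Path.extend_apply _ t.2]
    simpa [F] using this
  have e2 : segment F 2⁻¹ 1 = q.toContinuousMap := by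
    ext t
    have ht := t.2.1
    have : (p.trans q).extend ((1 - t : ℝ) * 2⁻¹ + t) = q t := by
      rw [Path.extend_trans_of_half_le _ _ (by linarith), ← Path.extend_apply q t.2]
      congr 1
      ring
    simpa [F] using this
  have e3 : segment F 0 1 = (p.trans q).toContinuousMap := by
    ext t
    simp [F]
  rw [← e1, ← e2, ← e3, pathClass_segment_add]

/-- Paths in a simply connected subspace with the same endpoints have the same class. -/
lemma pathClass_eq_of_isSimplyConnected {A : Set X} (hA : IsSimplyConnected A) {x y : X}
    (p q : Path x y) (hp : ∀ t, p t ∈ A) (hq : ∀ t, q t ∈ A) :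
    pathClass p.toContinuousMap = pathClass q.toContinuousMap := by
  have := hA.simplyConnectedSpace
  have hx : x ∈ A := by simpa using hp 0
  have hy : y ∈ A := by simpa using hp 1
  let p' : Path (⟨x, hx⟩ : A) ⟨y, hy⟩ :=
    ⟨⟨fun t => ⟨p t, hp t⟩, by fun_prop⟩, by simp, by simp⟩
  let q' : Path (⟨x, hx⟩ : A) ⟨y, hy⟩ :=
    ⟨⟨fun t => ⟨q t, hq t⟩, by fun_prop⟩, by simp, by simp⟩
  have h := (SimplyConnectedSpace.paths_homotopic p' q').map
    (⟨Subtype.val, continuous_subtype_val⟩ : C(A, X))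
  exact pathClass_eq_of_homotopic h

end singularSSet

end Singular

/-! ### Edge chains in the Rips complex and sampling of paths. -/

section RipsChains

open Simplicial

variable {X : Type u} [MetricSpace X] {r : ℝ}

namespace Rips

open Classical in
-- The strict bound passes to the diameter because the largest of finitely many distances is
-- attained.
lemma image_mem_faces {n : ℕ} {x : Fin (n + 1) → X} (h : ∀ i j, dist (x i) (x j) < r) :
    Finset.univ.image x ∈ (Rips X r).faces := by
  refine ⟨Finset.univ_nonempty.image _, ?_⟩
  obtain ⟨m, -, hm⟩ := Finset.exists_max_image (Finset.univ : Finset (Fin (n + 1) × Fin (n + 1)))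
    (fun m => dist (x m.1) (x m.2)) Finset.univ_nonempty
  refine lt_of_le_of_lt (Metric.diam_le_of_forall_dist_le dist_nonneg ?_) (h m.1 m.2)
  intro a ha b hb
  obtain ⟨i, -, rfl⟩ := Finset.mem_image.1 (Finset.mem_coe.1 ha)
  obtain ⟨j, -, rfl⟩ := Finset.mem_image.1 (Finset.mem_coe.1 hb)
  exact hm (i, j) (Finset.mem_univ _)

/-- The simplex of the Rips complex with the given ordered vertices. -/
def simplex {n : ℕ} (x : Fin (n + 1) → X) (h : ∀ i j, dist (x i) (x j) < r) :
    (Rips X r).orderedSSet _⦋n⦌ :=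
  ⟨x, image_mem_faces h⟩

/-- The `i`-th vertex of an ordered simplex of the Rips complex. -/
def vertex {n : ℕ} (σ : (Rips X r).orderedSSet _⦋n⦌) (i : Fin (n + 1)) : X := σ.1 i

lemma vertex_simplex {n : ℕ} (x : Fin (n + 1) → X) (h : ∀ i j, dist (x i) (x j) < r)
    (i : Fin (n + 1)) : vertex (simplex x h) i = x i := rfl

lemma simplex_ext {n : ℕ} {σ τ : (Rips X r).orderedSSet _⦋n⦌}
    (h : ∀ i, vertex σ i = vertex τ i) : σ = τ :=
  Subtype.ext (funext h)

lemma dist_vertex_lt {n : ℕ} (σ : (Rips X r).orderedSSet _⦋n⦌) (i j : Fin (n + 1)) :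
    dist (vertex σ i) (vertex σ j) < r := by
  classical
  refine lt_of_le_of_lt (Metric.dist_le_diam_of_mem (Finset.finite_toSet _).isBounded ?_ ?_) σ.2.2
  · exact Finset.mem_coe.2 (Finset.mem_image_of_mem σ.1 (Finset.mem_univ i))
  · exact Finset.mem_coe.2 (Finset.mem_image_of_mem σ.1 (Finset.mem_univ j))

lemma dist_pair_lt {x y : X} (h : dist x y < r) (i j : Fin 2) :
    dist (![x, y] i) (![x, y] j) < r := by
  have hr := dist_nonneg.trans_lt h
  fin_cases i <;> fin_cases j <;> simp [hr, h, dist_comm y x]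

/-- The `0`-simplex given by a point. -/
def pointSimplex (hr : 0 < r) (x : X) : (Rips X r).orderedSSet _⦋0⦌ :=
  simplex (fun _ => x) (by simpa)

lemma pointSimplex_vertex (hr : 0 < r) (σ : (Rips X r).orderedSSet _⦋0⦌) :
    pointSimplex hr (vertex σ 0) = σ :=
  simplex_ext fun i => by fin_cases i; rfl

variable (r) in
open Classical in
/-- The oriented edge from `x` to `y`, as an integral chain of the Rips complex; it is zero if the
two points are too far from each other. -/
noncomputable def edgeChain (x y : X) : FreeAbelianGroup ((Rips X r).orderedSSet _⦋1⦌) :=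
  if h : dist x y < r then .of (simplex ![x, y] (dist_pair_lt h)) else 0

lemma edgeChain_of_lt {x y : X} (h : dist x y < r) :
    edgeChain r x y = .of (simplex ![x, y] (dist_pair_lt h)) := dif_pos h

lemma edgeChain_vertex (σ : (Rips X r).orderedSSet _⦋1⦌) :
    edgeChain r (vertex σ 0) (vertex σ 1) = .of σ := by
  rw [edgeChain_of_lt (dist_vertex_lt σ 0 1)]
  congr 1
  refine simplex_ext fun i => ?_
  fin_cases i <;> rfl

lemma intBoundary_edgeChain (hr : 0 < r) {x y : X} (h : dist x y < r) :
    (Rips X r).orderedSSet.intBoundary 0 (edgeChain r x y) =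
      .of (pointSimplex hr y) - .of (pointSimplex hr x) := by
  rw [edgeChain_of_lt h, SSet.intBoundary_zero_of]
  congr 2 <;> refine simplex_ext fun i => ?_ <;> fin_cases i <;> rfl

lemma map_incl_edgeChain {s : ℝ} (hrs : r ≤ s) {x y : X} (h : dist x y < r) :
    FreeAbelianGroup.map ((PreAbstractSimplicialComplex.orderedSSetIncl (Rips_mono X hrs)).app
      (op ⦋1⦌)) (edgeChain r x y) = edgeChain s x y := by
  rw [edgeChain_of_lt h, edgeChain_of_lt (h.trans_le hrs), FreeAbelianGroup.map_of_apply]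
  rfl

variable (r) in
/-- The class modulo boundaries of the edge from `x` to `y`. -/
noncomputable def edgeClass (x y : X) : (Rips X r).orderedSSet.ChainClass :=
  (Rips X r).orderedSSet.chainClass (edgeChain r x y)

lemma chainClass_of (σ : (Rips X r).orderedSSet _⦋1⦌) :
    (Rips X r).orderedSSet.chainClass (.of σ) = edgeClass r (vertex σ 0) (vertex σ 1) := by
  rw [edgeClass, edgeChain_vertex]

lemma edgeClass_add {x y z : X} (hxy : dist x y < r) (hyz : dist y z < r) (hxz : dist x z < r) :
    edgeClass r x y + edgeClass r y z = edgeClass r x z := by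
  have hr := dist_nonneg.trans_lt hxy
  have h : ∀ i j, dist (![x, y, z] i) (![x, y, z] j) < r := by
    intro i j
    fin_cases i <;> fin_cases j <;>
      simp [hr, hxy, hyz, hxz, dist_comm y x, dist_comm z x, dist_comm z y]
  have := (Rips X r).orderedSSet.chainClass_triangle (simplex _ h)
  rw [chainClass_of, chainClass_of, chainClass_of, add_comm] at this
  exact this

lemma edgeClass_self (x : X) : edgeClass r x x = 0 := by
  by_cases hr : 0 < r
  · have h : dist x x < r := by simpa
    exact add_eq_left.1 (edgeClass_add h h h)
  · simp [edgeClass, edgeChain, hr]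

/-- A chain of edges with vertices in a set of small diameter is homologous to a single edge. -/
lemma sum_edgeClass_eq (q : ℕ → X) (n : ℕ)
    (h : ∀ i ≤ n, dist (q 0) (q i) < r) (h' : ∀ i < n, dist (q i) (q (i + 1)) < r) :
    ∑ i ∈ Finset.range n, edgeClass r (q i) (q (i + 1)) = edgeClass r (q 0) (q n) := by
  induction n with
  | zero => simp [edgeClass_self]
  | succ n ih =>
    -- Cone from `q 0`: each triangle `q 0`, `q n`, `q (n + 1)` needs only the assumed distances.
    rw [Finset.sum_range_succ, ih (fun i hi => h i (by lia)) (fun i hi => h' i (by lia)),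
      edgeClass_add (h n (by lia)) (h' n (by lia)) (h (n + 1) le_rfl)]

/-- The boundary of a fine grid is null-homologous. -/
lemma sum_edgeClass_grid (a : ℕ → ℕ → X) (n m : ℕ)
    (h : ∀ i < n, ∀ j < m, dist (a i j) (a (i + 1) j) < r ∧ dist (a i j) (a i (j + 1)) < r ∧
      dist (a i j) (a (i + 1) (j + 1)) < r ∧ dist (a (i + 1) j) (a (i + 1) (j + 1)) < r ∧
      dist (a i (j + 1)) (a (i + 1) (j + 1)) < r) :
    ∑ j ∈ Finset.range m, edgeClass r (a 0 j) (a 0 (j + 1)) +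
        ∑ i ∈ Finset.range n, edgeClass r (a i m) (a (i + 1) m) =
      ∑ i ∈ Finset.range n, edgeClass r (a i 0) (a (i + 1) 0) +
        ∑ j ∈ Finset.range m, edgeClass r (a n j) (a n (j + 1)) := by
  -- Within one strip, each cell is cut by its diagonal from `(i, j)` to `(i + 1, j + 1)` into two
  -- triangles; the strips are then stacked.
  have key (i : ℕ) (hi : i < n) :
      ∑ j ∈ Finset.range m, edgeClass r (a i j) (a i (j + 1)) +
        edgeClass r (a i m) (a (i + 1) m) = edgeClass r (a i 0) (a (i + 1) 0) +
        ∑ j ∈ Finset.range m, edgeClass r (a (i + 1) j) (a (i + 1) (j + 1)) := by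
    induction m with
    | zero => simp
    | succ m ih =>
      specialize ih fun i hi j hj => h i hi j (by lia)
      obtain ⟨h1, h2, h3, h4, h5⟩ := h i hi m (by lia)
      rw [Finset.sum_range_succ, Finset.sum_range_succ, add_assoc, edgeClass_add h2 h5 h3,
        ← edgeClass_add h1 h4 h3, ← add_assoc, ih, add_assoc]
  induction n with
  | zero => simp
  | succ n ih =>
    specialize ih (fun i hi => h i (by lia)) fun i hi => key i (by lia)
    rw [Finset.sum_range_succ, Finset.sum_range_succ, ← add_assoc, ih, add_assoc,
      key n (by lia), add_assoc]

variable (r) in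
/-- The chain of edges through the values of `p` at `0, 1 / n, 2 / n, …, 1`. -/
noncomputable def sampleChain (p : ℝ → X) (n : ℕ) :
    FreeAbelianGroup ((Rips X r).orderedSSet _⦋1⦌) :=
  ∑ i ∈ Finset.range n, edgeChain r (p (i / n)) (p ((i + 1 : ℕ) / n))

variable (r) in
/-- The mesh `1 / n` is fine enough for `p` at scale `r`. -/
def IsFine (p : ℝ → X) (n : ℕ) : Prop :=
  0 < n ∧ ∀ s ∈ Set.Icc (0 : ℝ) 1, ∀ t ∈ Set.Icc (0 : ℝ) 1, |s - t| ≤ 1 / n → dist (p s) (p t) < r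

lemma IsFine.of_le {p : ℝ → X} {n : ℕ} {s : ℝ} (h : IsFine r p n) (hrs : r ≤ s) : IsFine s p n :=
  ⟨h.1, fun a ha b hb hab => (h.2 a ha b hb hab).trans_le hrs⟩

lemma exists_isFine (hr : 0 < r) (p : C(ℝ, X)) : ∃ n, IsFine r p n := by
  have h := isCompact_Icc.uniformContinuousOn_of_continuous
    (p.continuous.continuousOn (s := Set.Icc (0 : ℝ) 1))
  obtain ⟨δ, hδ, h⟩ := Metric.uniformContinuousOn_iff.1 h r hr
  obtain ⟨n, hn⟩ := exists_nat_one_div_lt hδ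
  refine ⟨n + 1, n.succ_pos, fun s hs t ht hst => h s hs t ht ?_⟩
  rw [Real.dist_eq]
  exact hst.trans_lt (by exact_mod_cast hn)

lemma div_mem_Icc {i n : ℕ} (h : i ≤ n) : (i / n : ℝ) ∈ Set.Icc (0 : ℝ) 1 :=
  ⟨by positivity, div_le_one_of_le₀ (by exact_mod_cast h) (by positivity)⟩

lemma IsFine.dist_lt {p : ℝ → X} {n : ℕ} (h : IsFine r p n) {i : ℕ} (hi : i < n) :
    dist (p (i / n)) (p ((i + 1 : ℕ) / n)) < r := by
  refine h.2 _ (div_mem_Icc hi.le) _ (div_mem_Icc hi) ?_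
  rw [← sub_div, abs_div, abs_of_nonneg (by positivity : (0 : ℝ) ≤ n)]
  simp

lemma intBoundary_sampleChain (hr : 0 < r) {p : ℝ → X} {n : ℕ} (h : IsFine r p n) :
    (Rips X r).orderedSSet.intBoundary 0 (sampleChain r p n) =
      .of (pointSimplex hr (p 1)) - .of (pointSimplex hr (p 0)) := by
  have hn : (n : ℝ) ≠ 0 := by exact_mod_cast h.1.ne'
  rw [sampleChain, map_sum, Finset.sum_congr rfl fun i hi =>
    intBoundary_edgeChain hr (h.dist_lt (Finset.mem_range.1 hi)),
    Finset.sum_range_sub fun i : ℕ => FreeAbelianGroup.of (pointSimplex hr (p (i / n)))]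
  simp [div_self hn]

lemma map_incl_sampleChain {s : ℝ} (hrs : r ≤ s) {p : ℝ → X} {n : ℕ} (h : IsFine r p n) :
    FreeAbelianGroup.map ((PreAbstractSimplicialComplex.orderedSSetIncl (Rips_mono X hrs)).app
      (op ⦋1⦌)) (sampleChain r p n) = sampleChain s p n := by
  rw [sampleChain, map_sum]
  exact Finset.sum_congr rfl fun i hi => map_incl_edgeChain hrs (h.dist_lt (Finset.mem_range.1 hi))

variable (r) in
/-- The class modulo boundaries of `sampleChain`. -/
noncomputable def sampleClass (p : ℝ → X) (n : ℕ) : (Rips X r).orderedSSet.ChainClass :=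
  (Rips X r).orderedSSet.chainClass (sampleChain r p n)

lemma sampleClass_eq_sum (p : ℝ → X) (n : ℕ) : sampleClass r p n =
    ∑ i ∈ Finset.range n, edgeClass r (p (i / n)) (p ((i + 1 : ℕ) / n)) := by
  rw [sampleClass, sampleChain, map_sum]
  rfl

lemma _root_.Finset.sum_range_mul_eq {M : Type*} [AddCommMonoid M] (f : ℕ → M) (n m : ℕ) :
    ∑ k ∈ Finset.range (n * m), f k =
      ∑ i ∈ Finset.range n, ∑ j ∈ Finset.range m, f (i * m + j) := by
  induction n with
  | zero => simp
  | succ n ih => rw [Nat.succ_mul, Finset.sum_range_add, ih, Finset.sum_range_succ]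

/-- Any two points of one coarse interval have images at distance less than `r`, so its `m` small
edges collapse to the single coarse edge. -/
lemma IsFine.sampleClass_mul {p : ℝ → X} {n m : ℕ} (h : IsFine r p n) (hm : 0 < m) :
    sampleClass r p (n * m) = sampleClass r p n := by
  have hn : (0 : ℝ) < n := by exact_mod_cast h.1
  have hm' : (0 : ℝ) < m := by exact_mod_cast hm
  rw [sampleClass_eq_sum, sampleClass_eq_sum, Finset.sum_range_mul_eq]
  refine Finset.sum_congr rfl fun i hi => ?_
  have hi := Finset.mem_range.1 hi
  have hle {j : ℕ} (hj : j ≤ m) : i * m + j ≤ n * m := by nlinarith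
  have hd {j k : ℕ} (hj : j ≤ m) (hk : k ≤ m) :
      dist (p ((i * m + j : ℕ) / (n * m : ℕ))) (p ((i * m + k : ℕ) / (n * m : ℕ))) < r := by
    refine h.2 _ (div_mem_Icc (hle hj)) _ (div_mem_Icc (hle hk)) ?_
    have e : ((i * m + j : ℕ) / (n * m : ℕ) - (i * m + k : ℕ) / (n * m : ℕ) : ℝ) =
      (j - k) / m / n := by
      push_cast
      field_simp
      ring
    rw [e, abs_div, abs_of_pos hn]
    refine div_le_div_of_nonneg_right ?_ hn.le
    rw [abs_div, abs_of_pos hm', div_le_one hm', abs_le]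
    have : (j : ℝ) ≤ m := by exact_mod_cast hj
    have : (k : ℝ) ≤ m := by exact_mod_cast hk
    have : (0 : ℝ) ≤ j := by positivity
    have : (0 : ℝ) ≤ k := by positivity
    constructor <;> linarith
  refine (sum_edgeClass_eq (fun j => p ((i * m + j : ℕ) / (n * m : ℕ))) m
    (fun j hj => hd (Nat.zero_le _) hj) (fun j hj => hd hj.le hj)).trans ?_
  congr 2
  · push_cast
    field_simp
    ring
  · push_cast
    field_simp

/-- Both meshes are compared with the common refinement `n * m`. Hence the mesh chosen in
`fineSampling` is immaterial modulo boundaries. -/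
lemma IsFine.sampleClass_eq {p : ℝ → X} {n m : ℕ} (hn : IsFine r p n) (hm : IsFine r p m) :
    sampleClass r p n = sampleClass r p m := by
  rw [← hn.sampleClass_mul hm.1, mul_comm, hm.sampleClass_mul hn.1]

end Rips

end RipsChains

/-! ### Sampling and filling, and their inverse relations. -/

section Comparison

open Simplicial unitInterval singularSSet

variable {X : Type u} [MetricSpace X] {r R : ℝ}

namespace Rips

/-- The extension of a path to the real line, constant outside of the unit interval. -/
noncomputable def extendPath (p : C(I, X)) : C(ℝ, X) :=
  p.comp ⟨Set.projIcc 0 1 zero_le_one, continuous_projIcc⟩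

lemma extendPath_coe (p : C(I, X)) (t : I) : extendPath p t = p t := by
  simp [extendPath]

lemma segment_extendPath (p : C(I, X)) : segment (extendPath p) 0 1 = p := by
  ext t
  simp [extendPath_coe]

section Sampling

variable (hr : 0 < r)

/-- A fine subdivision of a path. -/
noncomputable def fineSampling (p : C(I, X)) : FreeAbelianGroup ((Rips X r).orderedSSet _⦋1⦌) :=
  sampleChain r (extendPath p) (exists_isFine hr (extendPath p)).choose

lemma chainClass_fineSampling (p : C(I, X)) {n : ℕ} (h : IsFine r (extendPath p) n) :
    (Rips X r).orderedSSet.chainClass (fineSampling hr p) = sampleClass r (extendPath p) n :=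
  (exists_isFine hr (extendPath p)).choose_spec.sampleClass_eq h

lemma exists_mesh (F : C(I × I, X)) (hr : 0 < r) : ∃ n : ℕ, 0 < n ∧ ∀ z w : I × I,
    |(z.1 - w.1 : ℝ)| ≤ 1 / n → |(z.2 - w.2 : ℝ)| ≤ 1 / n → dist (F z) (F w) < r := by
  obtain ⟨δ, hδ, h⟩ := Metric.uniformContinuous_iff.1
    (CompactSpace.uniformContinuous_of_continuous F.continuous) r hr
  obtain ⟨n, hn⟩ := exists_nat_one_div_lt hδ
  refine ⟨n + 1, n.succ_pos, fun z w h1 h2 => h ?_⟩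
  push_cast at h1 h2
  rw [Prod.dist_eq, max_lt_iff]
  exact ⟨h1.trans_lt hn, h2.trans_lt hn⟩

/-- Compatibility of sampling with the boundary of a square. -/
lemma chainClass_fineSampling_square (F : C(I × I, X)) {bottom top left right : C(I, X)}
    (hb : ∀ t, bottom t = F (0, t)) (ht : ∀ t, top t = F (1, t))
    (hl : ∀ t, left t = F (t, 0)) (hr' : ∀ t, right t = F (t, 1)) :
    (Rips X r).orderedSSet.chainClass (fineSampling hr bottom) +
        (Rips X r).orderedSSet.chainClass (fineSampling hr right) =
      (Rips X r).orderedSSet.chainClass (fineSampling hr left) +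
        (Rips X r).orderedSSet.chainClass (fineSampling hr top) := by
  obtain ⟨n, hn, h⟩ := exists_mesh F hr
  -- The sides of the square are parametrized by 1-Lipschitz maps in each coordinate, so the mesh of
  -- the grid is fine for all four at once.
  have fine {p : C(I, X)} {g : C(I, I × I)} (hp : ∀ t, p t = F (g t))
      (hg : ∀ s t : I, |((g s).1 - (g t).1 : ℝ)| ≤ |(s - t : ℝ)| ∧
        |((g s).2 - (g t).2 : ℝ)| ≤ |(s - t : ℝ)|) : IsFine r (extendPath p) n := by
    refine ⟨hn, fun s hs t ht hst => ?_⟩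
    rw [extendPath_coe p ⟨s, hs⟩, extendPath_coe p ⟨t, ht⟩, hp, hp]
    exact h _ _ ((hg _ _).1.trans hst) ((hg _ _).2.trans hst)
  rw [chainClass_fineSampling hr bottom
      (fine (g := ⟨fun t => (0, t), by fun_prop⟩) hb (by simp)),
    chainClass_fineSampling hr top
      (fine (g := ⟨fun t => (1, t), by fun_prop⟩) ht (by simp)),
    chainClass_fineSampling hr left
      (fine (g := ⟨fun t => (t, 0), by fun_prop⟩) hl (by simp)),
    chainClass_fineSampling hr right
      (fine (g := ⟨fun t => (t, 1), by fun_prop⟩) hr' (by simp))]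
  simp only [sampleClass_eq_sum]
  let c (i : ℕ) : I := Set.projIcc 0 1 zero_le_one (i / n : ℝ)
  have hc {i : ℕ} (hi : i < n) : |(c i - c (i + 1) : ℝ)| ≤ 1 / n := by
    simp only [c]
    rw [Set.projIcc_of_mem _ (div_mem_Icc hi.le), Set.projIcc_of_mem _ (div_mem_Icc hi),
      ← sub_div, abs_div, abs_of_nonneg (by positivity : (0 : ℝ) ≤ n)]
    simp
  have hn' : (n : ℝ) ≠ 0 := by exact_mod_cast hn.ne'
  have hc0 : c 0 = 0 := by simp [c]
  have hcn : c n = 1 := by simp [c, div_self hn']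
  have key := sum_edgeClass_grid (r := r) (fun i j => F (c i, c j)) n n fun i hi j hj => by
    refine ⟨h _ _ (hc hi) ?_, h _ _ ?_ (hc hj), h _ _ (hc hi) (hc hj), h _ _ ?_ (hc hj),
      h _ _ (hc hi) ?_⟩ <;> simp
  simp only [hc0, hcn, ← hb, ← ht, ← hl, ← hr'] at key
  exact key

/-- Sampling of singular simplices as a map to the chains of the Rips complex. -/
noncomputable def sampling : SSet.LowDegreeMap (singularSSet X) (Rips X r).orderedSSet where
  onVertex x := pointSimplex hr (vertexEquiv x)
  onEdge x := fineSampling hr (edgeEquiv x)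
  boundary_onEdge x := by
    rw [fineSampling,
      intBoundary_sampleChain hr (exists_isFine hr (extendPath (edgeEquiv x))).choose_spec,
      vertexEquiv_δ_zero, vertexEquiv_δ_one, ← extendPath_coe, ← extendPath_coe]
    rfl
  triangle x := by
    -- The square is mapped onto the triangle by collapsing its left side to vertex `0`; the other
    -- three sides become the faces, and the collapsed side contributes zero.
    let g : C(I × I, stdSimplex ℝ (Fin 3)) :=
      { toFun := fun z => trianglePoint (1 - z.2) (z.2 * (1 - z.1)) (z.2 * z.1)
          (sub_nonneg.2 z.2.2.2) (mul_nonneg z.2.2.1 (sub_nonneg.2 z.1.2.2))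
          (mul_nonneg z.2.2.1 z.1.2.1) (by ring)
        continuous_toFun := by
          refine Continuous.subtype_mk (continuous_pi fun i => ?_) _
          fin_cases i <;> simp <;> fun_prop }
    have h := chainClass_fineSampling_square hr ((simplexEquiv 2 x).comp g)
      (bottom := edgeEquiv ((singularSSet X).δ 2 x))
      (top := edgeEquiv ((singularSSet X).δ 1 x))
      (right := edgeEquiv ((singularSSet X).δ 0 x))
      (left := ContinuousMap.const I (simplexEquiv 2 x (stdSimplex.vertex 0)))
      (fun t => by
        rw [edgeEquiv_δ_two]
        refine congrArg (simplexEquiv 2 x) (Subtype.ext ?_)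
        simp [g, trianglePoint])
      (fun t => by
        rw [edgeEquiv_δ_one]
        refine congrArg (simplexEquiv 2 x) (Subtype.ext ?_)
        simp [g, trianglePoint])
      (fun t => by
        refine congrArg (simplexEquiv 2 x) (Subtype.ext (funext fun i => ?_))
        fin_cases i <;> simp [g, trianglePoint])
      (fun t => by
        rw [edgeEquiv_δ_zero]
        refine congrArg (simplexEquiv 2 x) (Subtype.ext ?_)
        simp [g, trianglePoint])
    have h0 (y : X) : (Rips X r).orderedSSet.chainClass
        (fineSampling hr (ContinuousMap.const I y)) = 0 := by
      refine (sampleClass_eq_sum _ _).trans (Finset.sum_eq_zero fun i _ => ?_)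
      exact edgeClass_self y
    rw [h0, zero_add, add_comm] at h
    exact h

/-- A mesh fine at scale `r` is fine at scale `s`, and the sampled class at scale `s` does not
depend on the mesh. -/
lemma chainClass_map_incl_sampling {s : ℝ} (hrs : r ≤ s) (hs : 0 < s)
    (x : (singularSSet X) _⦋1⦌) :
    (Rips X s).orderedSSet.chainClass (FreeAbelianGroup.map
      ((PreAbstractSimplicialComplex.orderedSSetIncl (Rips_mono X hrs)).app (op ⦋1⦌))
        ((sampling hr).onEdge x)) =
      (Rips X s).orderedSSet.chainClass ((sampling hs).onEdge x) := by
  have h := (exists_isFine hr (extendPath (edgeEquiv x))).choose_spec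
  refine (congrArg _ (map_incl_sampleChain hrs h)).trans ?_
  exact (chainClass_fineSampling hs (edgeEquiv x) (h.of_le hrs)).symm

end Sampling

/-! ### Filling Rips edges by paths in small balls. -/

section Filling

lemma joinedIn_ball (hX : SimplyConnectedUpToScale X R) (hr : 0 < r) (hrR : 2 * r < R)
    {x y : X} (h : dist x y < r) : JoinedIn (Metric.ball x r) x y :=
  (hX x r hr (by linarith)).isPathConnected.joinedIn x (Metric.mem_ball_self hr) y
    (Metric.mem_ball'.2 h)

variable (hX : SimplyConnectedUpToScale X R) (hr : 0 < r) (hrR : 2 * r < R)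

/-- A path in a small ball between two points close to each other. -/
noncomputable def shortPath {x y : X} (h : dist x y < r) : Path x y :=
  (joinedIn_ball hX hr hrR h).somePath

lemma shortPath_mem {x y : X} (h : dist x y < r) (t : I) :
    shortPath hX hr hrR h t ∈ Metric.ball x r :=
  (joinedIn_ball hX hr hrR h).somePath_mem t

/-- Both paths lie in the ball of radius `2 * r` about `x`; this is where simple connectedness
enters. -/
lemma pathClass_eq_shortPath {x y : X} (h : dist x y < r) (p : Path x y)
    (hp : ∀ t, p t ∈ Metric.ball x (2 * r)) :
    pathClass p.toContinuousMap = pathClass (shortPath hX hr hrR h).toContinuousMap :=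
  pathClass_eq_of_isSimplyConnected (hX x (2 * r) (by linarith) hrR) _ _ hp fun t =>
    Metric.ball_subset_ball (by linarith) (shortPath_mem hX hr hrR h t)

lemma pathClass_shortPath_add {x y z : X} (hxy : dist x y < r) (hyz : dist y z < r)
    (hxz : dist x z < r) :
    pathClass (shortPath hX hr hrR hxy).toContinuousMap +
      pathClass (shortPath hX hr hrR hyz).toContinuousMap =
      pathClass (shortPath hX hr hrR hxz).toContinuousMap := by
  rw [← pathClass_trans]
  refine pathClass_eq_shortPath hX hr hrR hxz _ fun t => ?_
  have ht : _ ∈ Set.range _ := Set.mem_range_self (f := (shortPath hX hr hrR hxy).trans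
    (shortPath hX hr hrR hyz)) t
  rw [Path.trans_range] at ht
  rcases ht with ⟨s, hs⟩ | ⟨s, hs⟩
  · rw [← hs]
    exact Metric.ball_subset_ball (by linarith) (shortPath_mem hX hr hrR hxy s)
  · rw [← hs]
    -- The second path lies in the `r`-ball about `y`, and `dist x y < r`, which accounts for the
    -- radius `2 * r`.
    refine Metric.ball_subset_ball' ?_ (shortPath_mem hX hr hrR hyz s)
    rw [dist_comm]
    linarith

/-- The singular `1`-simplex given by a short path along an edge of the Rips complex. -/
noncomputable def fillEdge (τ : (Rips X r).orderedSSet _⦋1⦌) : (singularSSet X) _⦋1⦌ :=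
  edgeEquiv.symm (shortPath hX hr hrR (dist_vertex_lt τ 0 1)).toContinuousMap

/-- Filling of the simplices of the Rips complex by singular simplices. -/
noncomputable def filling : SSet.LowDegreeMap (Rips X r).orderedSSet (singularSSet X) where
  onVertex τ := vertexEquiv.symm (vertex τ 0)
  onEdge τ := .of (fillEdge hX hr hrR τ)
  boundary_onEdge τ := by
    rw [SSet.intBoundary_zero_of]
    congr 2
    · rw [Equiv.eq_symm_apply, vertexEquiv_δ_zero, fillEdge, Equiv.apply_symm_apply]
      exact Path.target _
    · rw [Equiv.eq_symm_apply, vertexEquiv_δ_one, fillEdge, Equiv.apply_symm_apply]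
      exact Path.source _
  triangle τ := by
    rw [add_comm]
    exact pathClass_shortPath_add hX hr hrR (dist_vertex_lt τ 0 1) (dist_vertex_lt τ 1 2)
      (dist_vertex_lt τ 0 2)

/-- All samples of the short path are within `r` of its starting vertex, so `sum_edgeClass_eq`
contracts them to the original edge. -/
lemma chainClass_sampling_filling (τ : (Rips X r).orderedSSet _⦋1⦌) :
    (Rips X r).orderedSSet.chainClass (FreeAbelianGroup.lift (sampling hr).onEdge
      ((filling hX hr hrR).onEdge τ)) = (Rips X r).orderedSSet.chainClass (.of τ) := by
  let p := (shortPath hX hr hrR (dist_vertex_lt τ 0 1)).toContinuousMap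
  have e : FreeAbelianGroup.lift (sampling hr).onEdge ((filling hX hr hrR).onEdge τ) =
      fineSampling hr p := by
    simp [filling, sampling, fillEdge, p]
  obtain ⟨n, hn⟩ := exists_isFine hr (extendPath p)
  have hn' : (n : ℝ) ≠ 0 := by exact_mod_cast hn.1.ne'
  have hp0 : extendPath p 0 = vertex τ 0 :=
    (extendPath_coe p 0).trans (Path.source _)
  have hp1 : extendPath p 1 = vertex τ 1 :=
    (extendPath_coe p 1).trans (Path.target _)
  rw [e, chainClass_fineSampling hr p hn, sampleClass_eq_sum, chainClass_of,
    sum_edgeClass_eq (fun i : ℕ => extendPath p (i / n)) n _ fun i hi => hn.dist_lt hi]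
  · simp [div_self hn', hp0, hp1]
  · intro i _
    rw [Nat.cast_zero, zero_div, hp0, dist_comm]
    exact shortPath_mem hX hr hrR (dist_vertex_lt τ 0 1) _

/-- A path is homologous to the sum of its pieces. Each piece of a fine subdivision stays within `r`
of its starting point, so `pathClass_eq_shortPath` identifies it with the filling of the sampled
edge. -/
lemma chainClass_filling_sampling (x : (singularSSet X) _⦋1⦌) :
    (singularSSet X).chainClass (FreeAbelianGroup.lift (filling hX hr hrR).onEdge
      ((sampling hr).onEdge x)) = (singularSSet X).chainClass (.of x) := by
  let p := extendPath (edgeEquiv x)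
  obtain ⟨n, hn, e⟩ : ∃ n, IsFine r p n ∧ (sampling hr).onEdge x = sampleChain r p n :=
    ⟨_, (exists_isFine hr (extendPath (edgeEquiv x))).choose_spec, rfl⟩
  have hn' : (n : ℝ) ≠ 0 := by exact_mod_cast hn.1.ne'
  have hpx : (singularSSet X).chainClass (.of x) = pathClass (segment p 0 1) := by
    rw [segment_extendPath, pathClass, Equiv.symm_apply_apply]
  have hsum := sum_pathClass_segment p (fun i : ℕ => (i / n : ℝ)) n
  rw [Nat.cast_zero, zero_div, div_self hn'] at hsum
  rw [e, hpx, ← hsum, sampleChain, map_sum, map_sum]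
  refine Finset.sum_congr rfl fun i hi => ?_
  have hi := Finset.mem_range.1 hi
  have hd := hn.dist_lt hi
  rw [edgeChain_of_lt hd, FreeAbelianGroup.lift_apply_of]
  let q : Path (p (i / n)) (p ((i + 1 : ℕ) / n)) :=
    ⟨segment p (i / n) ((i + 1 : ℕ) / n), by simp, by simp⟩
  refine (pathClass_eq_shortPath hX hr hrR hd q fun t => ?_).symm
  have ht0 := t.2.1
  have ht1 := t.2.2
  have hmem := div_mem_Icc hi.le
  have hmem' := div_mem_Icc (Nat.succ_le_of_lt hi)
  have : dist (p ((1 - t : ℝ) • (i / n : ℝ) + (t : ℝ) • ((i + 1 : ℕ) / n : ℝ)))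
      (p (i / n)) < r := by
    refine hn.2 _ (convex_Icc (0 : ℝ) 1 hmem hmem' (by linarith) ht0 (by ring)) _ hmem ?_
    have e : (1 - t : ℝ) • (i / n : ℝ) + (t : ℝ) • ((i + 1 : ℕ) / n : ℝ) - i / n = t / n := by
      simp only [smul_eq_mul]
      push_cast
      ring
    rw [e, abs_of_nonneg (by positivity)]
    gcongr
  exact Metric.ball_subset_ball (by linarith) (Metric.mem_ball.2 this)

/-- The comparison isomorphism between the truncated chain complexes in homology. -/
noncomputable def comparisonIso (A : AddCommGrpCat.{max u v}) :
    (((singularSSet X).chainComplex A).sc' 2 1 0).homology ≅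
      (((Rips X r).orderedSSet.chainComplex A).sc' 2 1 0).homology :=
  SSet.LowDegreeMap.shortIso A (sampling hr) (filling hX hr hrR)
    (fun x => by simp [sampling, filling, pointSimplex, vertex_simplex])
    (chainClass_filling_sampling hX hr hrR)
    (fun τ => by simp [sampling, filling, pointSimplex_vertex])
    (chainClass_sampling_filling hX hr hrR)

end Filling

end Rips

end Comparison

theorem theorem4p10 (X : Type u) [MetricSpace X] [CompactSpace X]
    (G : Type (max u v)) [AddCommGroup G] (R : ℝ) (hR : 0 < R)
    (hX : SimplyConnectedUpToScale X R) (r : ℝ) (hr : 0 < r) (hrR : r < R / 3) :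
    Nonempty ((Rips X r).simplicialHomology (AddCommGrpCat.of G) 1 ≅
      singularHomologyGroup X (AddCommGrpCat.of G) 1) ∧
    ∀ (r' : ℝ) (hrr' : r < r'), r' < R / 3 →
      IsIso (PreAbstractSimplicialComplex.simplicialHomologyIncl (Rips_mono X hrr'.le)
        (AddCommGrpCat.of G) 1) := by
  have h2 : 2 * r < R := by linarith
  refine ⟨⟨(SSet.homologyOneIso (Rips X r).orderedSSet (AddCommGrpCat.of G)).trans
    ((Rips.comparisonIso hX hr h2 _).symm.trans
      (SSet.homologyOneIso (singularSSet X) (AddCommGrpCat.of G)).symm)⟩, ?_⟩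
  intro r' hrr' hr'R
  have hr' : 0 < r' := hr.trans hrr'
  have h2' : 2 * r' < R := by linarith
  refine SSet.isIso_homologyMap_one _ _ ?_
  -- In homology, `sampling hr` followed by the inclusion is `sampling hr'`; both samplings are
  -- isomorphisms, hence so is the inclusion.
  have h := SSet.LowDegreeMap.homologyMap_comp_incl (AddCommGrpCat.of G) (Rips.sampling hr)
    (Rips.sampling hr') (PreAbstractSimplicialComplex.orderedSSetIncl (Rips_mono X hrr'.le))
    (fun _ => rfl) (Rips.chainClass_map_incl_sampling hr hrr'.le hr')
  have i₁ : IsIso (ShortComplex.homologyMap ((Rips.sampling hr).shortMap (AddCommGrpCat.of G))) :=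
    (Rips.comparisonIso hX hr h2 _).isIso_hom
  have i₂ : IsIso (ShortComplex.homologyMap ((Rips.sampling hr').shortMap (AddCommGrpCat.of G))) :=
    (Rips.comparisonIso hX hr' h2' _).isIso_hom
  rw [← h] at i₂
  exact IsIso.of_isIso_comp_left
    (ShortComplex.homologyMap ((Rips.sampling hr).shortMap (AddCommGrpCat.of G))) _
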